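/- Let $k$ be a field, $R=k[x,y,z,u]$ the polynomial ring in four variables with the standard grading, and $\mathfrak m=(x,y,z,u)$. For an ideal $I$ of $R$ let $\operatorname{astab}(I)$ be the least integer $a\ge 1$ such that $\operatorname{Ass}(R/I^n)=\operatorname{Ass}(R/I^a)$ for all $n\ge a$, and let $\operatorname{dstab}(I)$ be the least integer $d\ge 1$ such that $\operatorname{depth}(R/I^n)=\operatorname{depth}(R/I^d)$ for all $n\ge d$, where $\operatorname{depth}(M)$ is the supremum of the lengths of $M$-regular sequences contained in $\mathfrak m$. Then for every integer $c\ge 0$ there are homogeneous ideals $I$ and $J$ of $R$ such that (i) $\operatorname{astab}(I)-\operatorname{dstab}(I)\ge c$, and (ii) $\operatorname{dstab}(J)-\operatorname{astab}(J)\ge c$. Explicitly, for every $c\ge 1$ the ideal $I=(x^{c+1}z^{c},\,u^{2c-1}yz,\,u^{2c+1})$ has $\operatorname{astab}(I)=c+1$ and $\operatorname{dstab}(I)=1$; and for every $c\ge 2$ the ideal $J=(x^{c}y^{c-1},\,x^{c-1}y^{c-1}z,\,z^{c}u^{c})$ has $\operatorname{astab}(J)=1$ and $\operatorname{dstab}(J)=c+1$.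 -/

import Mathlib

namespace PowerStability

open MvPolynomial

/-- The depth of an `R`-module `M` with respect to an ideal `m`: the supremum of the lengths of
the `M`-regular sequences consisting of elements of `m`. -/
noncomputable def depth {R : Type*} [CommRing R] (m : Ideal R) (M : Type*) [AddCommGroup M]
    [Module R M] : ℕ∞ :=
  ⨆ rs ∈ {rs : List R | (∀ r ∈ rs, r ∈ m) ∧ RingTheory.Sequence.IsRegular M rs},
    (rs.length : ℕ∞)

/-- `a` is the index of Ass-stability `astab(I)`: the least integer `a ≥ 1` such that
`Ass(R/I^n) = Ass(R/I^a)` for all `n ≥ a`. -/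
def IsAstab {R : Type*} [CommRing R] (I : Ideal R) (a : ℕ) : Prop :=
  IsLeast {a : ℕ | 1 ≤ a ∧
    ∀ n, a ≤ n → associatedPrimes R (R ⧸ I ^ n) = associatedPrimes R (R ⧸ I ^ a)} a

/-- `d` is the index of depth stability `dstab(I)` with respect to `m`: the least integer `d ≥ 1`
such that `depth(R/I^n) = depth(R/I^d)` for all `n ≥ d`. -/
def IsDstab {R : Type*} [CommRing R] (m I : Ideal R) (d : ℕ) : Prop :=
  IsLeast {d : ℕ | 1 ≤ d ∧ ∀ n, d ≤ n → depth m (R ⧸ I ^ n) = depth m (R ⧸ I ^ d)} d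

/-- The ideal `(x^(c+1) z^c, u^(2c-1) y z, u^(2c+1))` of `k[x,y,z,u]` (used for `c ≥ 1`);
the variables `x, y, z, u` are `X 0, X 1, X 2, X 3`. -/
noncomputable def idealI (k : Type*) [Field k] (c : ℕ) : Ideal (MvPolynomial (Fin 4) k) :=
  Ideal.span {X 0 ^ (c + 1) * X 2 ^ c, X 3 ^ (2 * c - 1) * X 1 * X 2, X 3 ^ (2 * c + 1)}

/-- The ideal `(x^c y^(c-1), x^(c-1) y^(c-1) z, z^c u^c)` of `k[x,y,z,u]` (used for `c ≥ 2`);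
the variables `x, y, z, u` are `X 0, X 1, X 2, X 3`. -/
noncomputable def idealJ (k : Type*) [Field k] (c : ℕ) : Ideal (MvPolynomial (Fin 4) k) :=
  Ideal.span {X 0 ^ c * X 1 ^ (c - 1), X 0 ^ (c - 1) * X 1 ^ (c - 1) * X 2, X 2 ^ c * X 3 ^ c}

end PowerStability

attribute [local instance] MvPolynomial.gradedAlgebra

/-!
The associated primes of a monomial ideal `U` are the colons `U : x ^ w` by monomials that are
generated by variables, so `Ass (R / I ^ n)` and `Ass (R / J ^ n)` are determined by the exponents
of the monomials in these powers, which are described by a few linear inequalities.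

For `I`, the prime `(x, y, u)` is associated to every power while `(x, y, z, u)` never is. Hence
`x + y + z + u` is a nonzerodivisor modulo `I ^ n`, and modulo this element `(x, y, u)` becomes the
maximal ideal, so the depth is always one. The prime `(x, z, u)` appears only from the power `c + 1`
on, and no prime appears after that.

For `J`, every power has the associated primes `(x, z)`, `(x, u)`, `(y, z)`, `(y, u)`. Thus `x - y`
is always a nonzerodivisor, and the quotient by it is the quotient of `k[x, z, u]` by a power of
another monomial ideal, to which the maximal ideal is associated exactly from the power `c + 1` on.
Before that `z - u` is a second regular element, and afterwards the depth is one.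
-/

namespace PowerStability

open MvPolynomial RingTheory.Sequence
open scoped Pointwise

section Depth

variable {R M : Type*} [CommRing R] [AddCommGroup M] [Module R M]

theorem length_le_depth {m : Ideal R} (hM : m • (⊤ : Submodule R M) ≠ ⊤) {rs : List R}
    (hrs : ∀ r ∈ rs, r ∈ m) (hreg : IsWeaklyRegular M rs) : (rs.length : ℕ∞) ≤ depth m M := by
  have hle : Ideal.ofList rs ≤ m := Ideal.span_le.2 hrs
  have htop : (⊤ : Submodule R M) ≠ Ideal.ofList rs • ⊤ := fun h =>
    hM (top_le_iff.1 (h.le.trans (Submodule.smul_mono_left hle)))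
  exact le_iSup₂_of_le (f := fun (rs : List R)
    (_ : rs ∈ {rs : List R | (∀ r ∈ rs, r ∈ m) ∧ IsRegular M rs}) => (rs.length : ℕ∞))
    rs ⟨hrs, hreg, htop⟩ le_rfl

theorem exists_smul_mem_smul_top_of_socle {m : Ideal R} {f g : R} (hf : IsSMulRegular M f)
    (hg : IsSMulRegular M g) (hgm : g ∈ m) {v : M} (hv : v ∉ f • (⊤ : Submodule R M))
    (hmv : ∀ r ∈ m, r • v ∈ f • (⊤ : Submodule R M)) :
    ∃ w ∉ g • (⊤ : Submodule R M), ∀ r ∈ m, r • w ∈ g • (⊤ : Submodule R M) := by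
  obtain ⟨w, -, hw : f • w = g • v⟩ := hmv g hgm
  refine ⟨w, ?_, fun r hr => ?_⟩
  · rintro ⟨b, -, rfl : g • b = w⟩
    refine hv ⟨b, trivial, hg ?_⟩
    change g • f • b = g • v
    rw [smul_comm, hw]
  · obtain ⟨b, -, hb : f • b = r • v⟩ := hmv r hr
    refine ⟨b, trivial, hf ?_⟩
    change f • g • b = f • r • w
    rw [smul_comm f g, hb, smul_comm f r, hw, smul_comm]

theorem depth_le_one_of_socle {m : Ideal R} {f : R} (hf : IsSMulRegular M f) {v : M}
    (hv : v ∉ f • (⊤ : Submodule R M)) (hmv : ∀ r ∈ m, r • v ∈ f • (⊤ : Submodule R M)) :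
    depth m M ≤ 1 := by
  refine iSup₂_le ?_
  rintro (_ | ⟨g, _ | ⟨h, t⟩⟩) ⟨hm, hreg⟩
  · simp
  · simp
  · exfalso
    obtain ⟨hg, hh, -⟩ : IsSMulRegular M g ∧ IsSMulRegular (QuotSMulTop g M) h ∧ _ := by
      simpa only [isWeaklyRegular_cons_iff] using hreg.toIsWeaklyRegular
    obtain ⟨w, hw, hmw⟩ := exists_smul_mem_smul_top_of_socle hf hg (hm g (by simp)) hv hmv
    exact hw (mem_of_isSMulRegular_quotient_of_smul_mem hh (hmw h (hm h (by simp))))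

/-- Nakayama's lemma, applied to the submodule of elements killed by `P`, produces an element
outside `f • M` killed by `P`. -/
theorem exists_notMem_smul_top_of_mem_associatedPrimes [IsNoetherianRing R]
    [Module.Finite R M] {P : Ideal R} {f : R}
    (hf : IsSMulRegular M f) (hP : P ∈ associatedPrimes R M) (hPf : P ⊔ Ideal.span {f} ≠ ⊤) :
    ∃ v ∉ f • (⊤ : Submodule R M), ∀ r ∈ P, r • v = 0 := by
  by_contra! hcon
  obtain ⟨-, x, hx⟩ := isAssociatedPrime_iff.1 hP
  have hPx (r : R) : r ∈ P ↔ r • x = 0 := by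
    rw [hx, Submodule.mem_colon_singleton, Submodule.mem_bot]
  let N := Submodule.torsionBySet R M P
  have mem_N {v : M} : v ∈ N ↔ ∀ r ∈ P, r • v = 0 := by
    simp [N, Submodule.mem_torsionBySet_iff]
  have hN : N ≤ Ideal.span {f} • N := fun v hv => by
    by_contra hvN
    obtain ⟨r, hr, hrv⟩ := hcon v (by
      rintro ⟨w, -, rfl : f • w = v⟩
      refine hvN (Submodule.smul_mem_smul (Ideal.mem_span_singleton_self f) (mem_N.2 ?_))
      refine fun r hr => hf.right_eq_zero_of_smul ?_
      rw [smul_comm, mem_N.1 hv r hr])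
    exact hrv (mem_N.1 hv r hr)
  obtain ⟨r, hrf, hrN⟩ := Submodule.exists_sub_one_mem_and_smul_eq_zero_of_fg_of_le_smul
    (Ideal.span {f}) N (IsNoetherian.noetherian N) hN
  have hrP : r ∈ P := (hPx r).2 (hrN x (mem_N.2 fun s hs => (hPx s).1 hs))
  refine hPf ((Ideal.eq_top_iff_one _).2 ?_)
  simpa using sub_mem (Ideal.mem_sup_left hrP) (Ideal.mem_sup_right hrf : r - 1 ∈ P ⊔ _)

theorem depth_le_one_of_mem_associatedPrimes [IsNoetherianRing R] [Module.Finite R M]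
    {m P : Ideal R} {f : R}
    (hf : IsSMulRegular M f) (hP : P ∈ associatedPrimes R M) (hPf : P ⊔ Ideal.span {f} ≠ ⊤)
    (hm : m ≤ P ⊔ Ideal.span {f}) : depth m M ≤ 1 := by
  obtain ⟨v, hv, hPv⟩ := exists_notMem_smul_top_of_mem_associatedPrimes hf hP hPf
  refine depth_le_one_of_socle hf hv fun r hr => ?_
  obtain ⟨p, hp, q, hq, rfl⟩ := Submodule.mem_sup.1 (hm hr)
  obtain ⟨s, rfl⟩ := Ideal.mem_span_singleton'.1 hq
  refine ⟨s • v, trivial, ?_⟩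
  change f • s • v = _
  rw [add_smul, hPv p hp, zero_add, mul_comm, mul_smul]

end Depth

section DepthQuotient

variable {R S : Type*} [CommRing R] [CommRing S] {m U : Ideal R} {f g : R} {φ : R →+* S}

theorem smul_top_quotient_ne_top (hm : m ≠ ⊤) (hU : U ≤ m) :
    m • (⊤ : Submodule R (R ⧸ U)) ≠ ⊤ := by
  have hmap : m • (⊤ : Submodule R (R ⧸ U)) = Submodule.map U.mkQ m := by
    rw [← Submodule.range_mkQ, ← Submodule.map_top, ← Submodule.map_smul'', smul_eq_mul,
      Ideal.mul_top]
  rw [hmap]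
  intro h
  have hcomap := congrArg (Submodule.comap U.mkQ) h
  rw [Submodule.comap_map_mkQ, Submodule.comap_top, sup_eq_right.2 hU] at hcomap
  exact hm hcomap

theorem one_le_depth_quotient (hm : m ≠ ⊤) (hU : U ≤ m) (hfm : f ∈ m)
    (hf : IsSMulRegular (R ⧸ U) f) : 1 ≤ depth m (R ⧸ U) := by
  simpa using length_le_depth (rs := [f]) (smul_top_quotient_ne_top hm hU) (by simpa using hfm)
    ((isWeaklyRegular_singleton_iff _ _).2 hf)

theorem mk_mem_smul_top_iff (hφ : Function.Surjective φ) (hker : RingHom.ker φ = Ideal.span {f})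
    {p : R} :
    (Submodule.Quotient.mk p : R ⧸ U) ∈ f • (⊤ : Submodule R (R ⧸ U)) ↔ φ p ∈ U.map φ := by
  have hmap : f • (⊤ : Submodule R (R ⧸ U)) = Submodule.map U.mkQ (Ideal.span {f}) := by
    rw [← Submodule.range_mkQ, ← Submodule.map_top, ← Submodule.map_pointwise_smul,
      ← Submodule.ideal_span_singleton_smul, smul_eq_mul, Ideal.mul_top]
  rw [hmap, ← Submodule.mkQ_apply, ← Submodule.mem_comap, Submodule.comap_map_mkQ, ← hker,
    ← Ideal.mem_comap, Ideal.comap_map_of_surjective' φ hφ]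

theorem two_le_depth_quotient (hm : m ≠ ⊤) (hU : U ≤ m) (hfm : f ∈ m) (hgm : g ∈ m)
    (hf : IsSMulRegular (R ⧸ U) f) (hφ : Function.Surjective φ)
    (hker : RingHom.ker φ = Ideal.span {f}) (hg : IsSMulRegular (S ⧸ U.map φ) (φ g)) :
    2 ≤ depth m (R ⧸ U) := by
  have hg' : IsSMulRegular (QuotSMulTop f (R ⧸ U)) g := by
    refine (isSMulRegular_quotient_iff_mem_of_smul_mem _ _).2 fun x hx => ?_
    obtain ⟨p, rfl⟩ := Submodule.Quotient.mk_surjective U x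
    rw [← Submodule.Quotient.mk_smul, mk_mem_smul_top_iff hφ hker, smul_eq_mul, map_mul] at hx
    exact (mk_mem_smul_top_iff hφ hker).2 (mem_of_isSMulRegular_quotient_of_smul_mem hg hx)
  exact length_le_depth (rs := [f, g]) (smul_top_quotient_ne_top hm hU) (by simp [hfm, hgm])
    ((isWeaklyRegular_cons_iff _ _ _).2 ⟨hf, (isWeaklyRegular_singleton_iff _ _).2 hg'⟩)

theorem mem_colon_bot_mk {p q : R} :
    q ∈ Submodule.colon ⊥ {(Submodule.Quotient.mk p : R ⧸ U)} ↔ q * p ∈ U := by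
  rw [Submodule.mem_colon_singleton, Submodule.mem_bot, ← Submodule.Quotient.mk_smul,
    Submodule.Quotient.mk_eq_zero, smul_eq_mul]

theorem depth_quotient_le_one [IsNoetherianRing S] (hf : IsSMulRegular (R ⧸ U) f)
    (hφ : Function.Surjective φ) (hker : RingHom.ker φ = Ideal.span {f}) {P : Ideal S}
    (hP : P ∈ associatedPrimes S (S ⧸ U.map φ)) (hm : m.map φ ≤ P) : depth m (R ⧸ U) ≤ 1 := by
  obtain ⟨hP, x, rfl⟩ := isAssociatedPrime_iff.1 hP
  obtain ⟨y, rfl⟩ := Submodule.Quotient.mk_surjective _ x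
  obtain ⟨p, rfl⟩ := hφ y
  refine depth_le_one_of_socle hf (v := Submodule.Quotient.mk p) (fun hp => ?_) fun r hr => ?_
  · refine hP.ne_top ((Ideal.eq_top_iff_one _).2 (mem_colon_bot_mk.2 ?_))
    simpa using (mk_mem_smul_top_iff hφ hker).1 hp
  · rw [← Submodule.Quotient.mk_smul, mk_mem_smul_top_iff hφ hker, smul_eq_mul, map_mul]
    exact mem_colon_bot_mk.1 (hm (Ideal.mem_map_of_mem φ hr))

end DepthQuotient

section LeadingTerm

variable {σ R : Type*} [CommRing R]

theorem card_support_sub_leadingTerm_lt (m : MonomialOrder σ) {f : MvPolynomial σ R}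
    (hf : f ≠ 0) : (f - m.leadingTerm f).support.card < f.support.card := by
  classical
  have hsupp : (f - m.leadingTerm f).support ⊆ f.support.erase (m.degree f) := fun b hb => by
    by_cases hbf : m.degree f = b
    · simp [MonomialOrder.leadingTerm, MonomialOrder.leadingCoeff, hbf] at hb
    · simpa [MonomialOrder.leadingTerm, coeff_monomial, hbf, Ne.symm hbf] using hb
  exact (Finset.card_le_card hsupp).trans_lt
    (Finset.card_erase_lt_of_mem (m.degree_mem_support hf))

theorem card_support_monomial_mul_le (a : σ →₀ ℕ) (f : MvPolynomial σ R) :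
    (monomial a 1 * f).support.card ≤ f.support.card := by
  classical
  have hsupp : (monomial a 1 * f).support ⊆ f.support.image (a + ·) := fun w hw => by
    rw [mem_support_iff, coeff_monomial_mul'] at hw
    split_ifs at hw with haw
    · exact Finset.mem_image.2 ⟨w - a, by simpa using hw, add_tsub_cancel_of_le haw⟩
    · exact absurd rfl hw
  exact (Finset.card_le_card hsupp).trans Finset.card_image_le

theorem monomial_mem_of_monomial_one_mem {U : Ideal (MvPolynomial σ R)} {w : σ →₀ ℕ}
    (hw : monomial w 1 ∈ U) (r : R) : monomial w r ∈ U := by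
  simpa [C_mul_monomial] using U.mul_mem_left (C r) hw

end LeadingTerm

section VariablePrimes

variable {σ R : Type*} [CommRing R]

theorem X_mem_span_X_image [Nontrivial R] {S : Set σ} {i : σ} :
    (X i : MvPolynomial σ R) ∈ Ideal.span (X '' S) ↔ i ∈ S := by
  classical
  simp [mem_ideal_span_X_image, support_X, Finsupp.single_apply]

theorem span_X_image_injective [Nontrivial R] :
    Function.Injective fun S : Set σ => (Ideal.span (X '' S) : Ideal (MvPolynomial σ R)) :=
  fun S S' h => Set.ext fun i => by
    rw [← X_mem_span_X_image (R := R), ← X_mem_span_X_image (R := R)]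
    exact iff_of_eq (congrArg (X i ∈ ·) h)

theorem aeval_sub_self_mem {P : Ideal (MvPolynomial σ R)} {g : σ → MvPolynomial σ R}
    (hg : ∀ i, g i - X i ∈ P) (p : MvPolynomial σ R) : aeval g p - p ∈ P := by
  have h : (Ideal.Quotient.mkₐ R P).comp (aeval g) = Ideal.Quotient.mkₐ R P :=
    algHom_ext fun i => by simpa using Ideal.Quotient.eq.2 (hg i)
  exact Ideal.Quotient.eq.1 (DFunLike.congr_fun h p)

theorem isPrime_span_X_image [IsDomain R] (S : Set σ) :
    (Ideal.span (X '' S) : Ideal (MvPolynomial σ R)).IsPrime := by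
  classical
  let g : σ → MvPolynomial σ R := fun i => if i ∈ S then 0 else X i
  suffices hker : Ideal.span (X '' S) = RingHom.ker (aeval (R := R) g) from
    hker ▸ RingHom.ker_isPrime _
  refine le_antisymm (Ideal.span_le.2 ?_) fun p hp => ?_
  · rintro _ ⟨i, hi, rfl⟩
    simp [g, hi]
  · have hg (i : σ) : g i - X i ∈ Ideal.span (X '' S) := by
      by_cases hi : i ∈ S
      · simpa [g, hi] using X_mem_span_X_image.2 hi
      · simp [g, hi]
    have h := aeval_sub_self_mem hg p
    rwa [RingHom.mem_ker.1 hp, zero_sub, neg_mem_iff] at h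

theorem idealOfVars_ne_top [Nontrivial R] : idealOfVars σ R ≠ ⊤ := fun h => by
  have h1 : (1 : MvPolynomial σ R) ∈ Ideal.span (X '' Set.univ) := by
    rw [Set.image_univ]
    exact (Ideal.eq_top_iff_one _).1 h
  simpa using mem_ideal_span_X_image.1 h1 0 (by simp)

theorem X_sub_X_mem_idealOfVars (i j : σ) : X i - X j ∈ idealOfVars σ R :=
  sub_mem (Ideal.subset_span ⟨i, rfl⟩) (Ideal.subset_span ⟨j, rfl⟩)

theorem exists_X_mem_of_monomial_mem {P : Ideal (MvPolynomial σ R)} (hP : P.IsPrime)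
    {b : σ →₀ ℕ} (hb : monomial b 1 ∈ P) : ∃ i, X i ∈ P ∧ b i ≠ 0 := by
  rw [monomial_eq, map_one, one_mul, Finsupp.prod, hP.prod_mem_iff] at hb
  obtain ⟨i, hi, hX⟩ := hb
  exact ⟨i, hP.mem_of_pow_mem _ hX, Finsupp.mem_support_iff.1 hi⟩

theorem monomial_mem_span_X_image {S : Set σ} {b : σ →₀ ℕ} {i : σ} (hi : i ∈ S) (hb : b i ≠ 0)
    (r : R) : monomial b r ∈ Ideal.span (X '' S : Set (MvPolynomial σ R)) :=
  mem_ideal_span_X_image.2 fun c hc => by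
    rw [Finset.mem_singleton.1 (support_monomial_subset hc)]
    exact ⟨i, hi, hb⟩

theorem eq_span_X_image_of_monomial_degree_mem (m : MonomialOrder σ)
    {P : Ideal (MvPolynomial σ R)} (hP : P.IsPrime)
    (hdeg : ∀ g ∈ P, g ≠ 0 → monomial (m.degree g) 1 ∈ P) :
    P = Ideal.span (X '' {i | X i ∈ P}) := by
  refine le_antisymm (fun g hg => ?_) (Ideal.span_le.2 (Set.image_subset_iff.2 fun i hi => hi))
  induction hn : g.support.card using Nat.strong_induction_on generalizing g with
  | _ n ih =>
  subst hn
  rcases eq_or_ne g 0 with rfl | hg0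
  · exact zero_mem _
  have hmon := hdeg g hg hg0
  have hlead : m.leadingTerm g ∈ P := monomial_mem_of_monomial_one_mem hmon _
  have hrest := ih _ (card_support_sub_leadingTerm_lt m hg0) _ (sub_mem hg hlead) rfl
  obtain ⟨i, hi, hne⟩ := exists_X_mem_of_monomial_mem hP hmon
  rw [← sub_add_cancel g (m.leadingTerm g)]
  exact add_mem hrest (monomial_mem_span_X_image (S := {i | X i ∈ P}) hi hne _)

end VariablePrimes

section MonomialIdeal

variable {σ R : Type*} [CommRing R] {T : Set (σ →₀ ℕ)} {hT : IsUpperSet T}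

theorem mem_restrictSupportIdeal {p : MvPolynomial σ R} :
    p ∈ restrictSupportIdeal R T hT ↔ ∀ w ∈ p.support, w ∈ T :=
  Iff.rfl

theorem mul_monomial_mem_restrictSupportIdeal {g : MvPolynomial σ R} {a : σ →₀ ℕ} :
    g * monomial a 1 ∈ restrictSupportIdeal R T hT ↔ ∀ b ∈ g.support, a + b ∈ T := by
  classical
  rw [mem_restrictSupportIdeal]
  refine ⟨fun h b hb => h _ ?_, fun h w hw => ?_⟩
  · rwa [add_comm, mem_support_iff, coeff_mul_monomial, mul_one, ← mem_support_iff]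
  · rw [mem_support_iff, coeff_mul_monomial'] at hw
    split_ifs at hw with haw
    · rw [← add_tsub_cancel_of_le haw]
      exact h _ (by simpa using hw)
    · exact absurd rfl hw

/-- If the leading monomial of `g` were not in `P`, then `P` would also be the colon of the monomial
ideal by a polynomial with fewer terms: the leading monomial of `g` times `f` without its leading
term. -/
theorem monomial_degree_mem_of_colon_isPrime [IsDomain R] (m : MonomialOrder σ)
    {P : Ideal (MvPolynomial σ R)} (hP : P.IsPrime) {f : MvPolynomial σ R}
    (hf : ∀ g, g ∈ P ↔ g * f ∈ restrictSupportIdeal R T hT) {g : MvPolynomial σ R} (hg : g ∈ P)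
    (hg0 : g ≠ 0) : monomial (m.degree g) 1 ∈ P := by
  induction hn : f.support.card using Nat.strong_induction_on generalizing f with
  | _ n ih =>
  subst hn
  by_contra hmon
  have hf0 : f ≠ 0 := by
    rintro rfl
    exact hP.ne_top ((Ideal.eq_top_iff_one _).2 ((hf 1).2 (by simp)))
  have hlead : m.degree f + m.degree g ∈ T := by
    refine (hf g).1 hg (?_ : _ ∈ (g * f).support)
    rw [add_comm, mem_support_iff, m.coeff_mul_of_degree_add]
    exact mul_ne_zero (m.leadingCoeff_ne_zero_iff.2 hg0) (m.leadingCoeff_ne_zero_iff.2 hf0)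
  have hin : monomial (m.degree g) 1 * m.leadingTerm f ∈ restrictSupportIdeal R T hT := by
    rw [MonomialOrder.leadingTerm, monomial_mul, one_mul, add_comm]
    exact fun w hw => Finset.mem_singleton.1 (support_monomial_subset hw) ▸ hlead
  refine hmon (ih _ ?_ (f := monomial (m.degree g) 1 * (f - m.leadingTerm f)) (fun h => ?_) rfl)
  · exact (card_support_monomial_mul_le _ _).trans_lt (card_support_sub_leadingTerm_lt m hf0)
  · have hsplit : h * (monomial (m.degree g) 1 * (f - m.leadingTerm f)) =
        h * monomial (m.degree g) 1 * f - h * (monomial (m.degree g) 1 * m.leadingTerm f) := by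
      ring
    rw [hsplit, Submodule.sub_mem_iff_left _ (Ideal.mul_mem_left _ h hin), ← hf]
    exact ⟨P.mul_mem_right _, fun hh => (hP.mem_or_mem hh).resolve_right hmon⟩

theorem colon_isPrime_eq_span_X_image [IsDomain R] [Finite σ] {P : Ideal (MvPolynomial σ R)}
    (hP : P.IsPrime) {f : MvPolynomial σ R}
    (hf : ∀ g, g ∈ P ↔ g * f ∈ restrictSupportIdeal R T hT) :
    P = Ideal.span (X '' {i | X i ∈ P}) := by
  have : Fintype σ := Fintype.ofFinite σ
  let : LinearOrder σ := LinearOrder.lift' (Fintype.equivFin σ) (Fintype.equivFin σ).injective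
  exact eq_span_X_image_of_monomial_degree_mem MonomialOrder.lex hP fun g hg hg0 =>
    monomial_degree_mem_of_colon_isPrime _ hP hf hg hg0

/-- The sets `S` of variables such that the colon of the monomial ideal with exponent set `T` by
some monomial `x ^ w` is generated by the variables in `S`. -/
def assVars (T : Set (σ →₀ ℕ)) : Set (Finset σ) :=
  {S | ∃ w, ∀ b, w + b ∈ T ↔ ∃ i ∈ S, b i ≠ 0}

theorem mem_assVars_iff {T : Set (σ →₀ ℕ)} (hT : IsUpperSet T) {S : Finset σ} :
    S ∈ assVars T ↔
      ∃ w, (∀ i ∈ S, w + Finsupp.single i 1 ∈ T) ∧ ∀ v ∈ T, ∃ i ∈ S, w i < v i := by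
  refine exists_congr fun w => ⟨fun h => ⟨fun i hi => (h _).2 ⟨i, hi, by simp⟩, fun v hv => ?_⟩,
    fun ⟨hS, hlt⟩ b => ⟨fun hb => ?_, fun ⟨i, hi, hne⟩ => hT ?_ (hS i hi)⟩⟩
  · obtain ⟨i, hi, hne⟩ := (h (v - w)).1 (hT le_add_tsub hv)
    exact ⟨i, hi, tsub_pos_iff_lt.1 (Nat.pos_of_ne_zero hne)⟩
  · obtain ⟨i, hi, hlt⟩ := hlt _ hb
    exact ⟨i, hi, (lt_add_iff_pos_right _).1 hlt |>.ne'⟩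
  · gcongr
    exact Finsupp.single_le_iff.2 (Nat.one_le_iff_ne_zero.2 hne)

theorem exists_notMem_of_mem_assVars {T : Set (σ →₀ ℕ)} {S : Finset σ} (hS : S ∈ assVars T) :
    ∃ w ∉ T, ∀ i ∈ S, w + Finsupp.single i 1 ∈ T := by
  obtain ⟨w, hw⟩ := hS
  exact ⟨w, fun h => by simpa using (hw 0).1 (by simpa using h),
    fun i hi => (hw _).2 ⟨i, hi, by simp⟩⟩

theorem exists_ne_zero_of_mem_assVars {T : Set (σ →₀ ℕ)} (hT : IsUpperSet T) {S : Finset σ}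
    (hS : S ∈ assVars T) {v : σ →₀ ℕ} (hv : v ∈ T) : ∃ i ∈ S, v i ≠ 0 :=
  let ⟨_, hw⟩ := hS
  (hw v).1 (hT le_add_self hv)

theorem toFinset_mem_assVars_of_colon_isPrime [Finite σ] {P : Ideal (MvPolynomial σ R)}
    (hP : P.IsPrime) {f : MvPolynomial σ R}
    (hf : ∀ g, g ∈ P ↔ g * f ∈ restrictSupportIdeal R T hT) :
    {i | X i ∈ P}.toFinite.toFinset ∈ assVars T := by
  by_contra hno
  have hb : ∀ w ∈ f.support, ∃ b, w + b ∈ T ∧ ∀ i, X i ∈ P → b i = 0 := fun w hw => by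
    by_contra! hcon
    refine hno ⟨w, fun b => ⟨fun h => by simpa using hcon b h, fun ⟨i, hi, hne⟩ => ?_⟩⟩
    have hXf : X i * f ∈ restrictSupportIdeal R T hT := (hf _).1 (by simpa using hi)
    rw [mul_comm, X, mul_monomial_mem_restrictSupportIdeal] at hXf
    refine hT ?_ (hXf w hw)
    rw [add_comm]
    gcongr
    exact Finsupp.single_le_iff.2 (Nat.one_le_iff_ne_zero.2 hne)
  choose! b hbT hbP using hb
  have hmon : monomial (∑ w ∈ f.support, b w) 1 ∈ P := by
    rw [hf, mul_comm, mul_monomial_mem_restrictSupportIdeal]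
    refine fun w hw => hT ?_ (hbT w hw)
    rw [add_comm]
    gcongr
    exact Finset.single_le_sum (f := b) (fun _ _ => zero_le) hw
  obtain ⟨i, hi, hne⟩ := exists_X_mem_of_monomial_mem hP hmon
  rw [Finsupp.finsetSum_apply] at hne
  exact hne (Finset.sum_eq_zero fun w hw => hbP w hw i hi)

theorem colon_monomial_eq {S : Finset σ} {w : σ →₀ ℕ}
    (hw : ∀ b, w + b ∈ T ↔ ∃ i ∈ S, b i ≠ 0) (g : MvPolynomial σ R) :
    g * monomial w 1 ∈ restrictSupportIdeal R T hT ↔ g ∈ Ideal.span (X '' (S : Set σ)) := by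
  simp only [mul_monomial_mem_restrictSupportIdeal, mem_ideal_span_X_image, hw, Finset.mem_coe]

theorem associatedPrimes_restrictSupportIdeal [IsDomain R] [IsNoetherianRing R] [Finite σ] :
    associatedPrimes (MvPolynomial σ R) (MvPolynomial σ R ⧸ restrictSupportIdeal R T hT) =
      (fun S : Finset σ => Ideal.span (X '' (S : Set σ))) '' assVars T := by
  ext P
  refine ⟨fun hPass => ?_, ?_⟩
  · obtain ⟨hP, x, hx⟩ := isAssociatedPrime_iff.1 hPass
    obtain ⟨f, rfl⟩ := Submodule.Quotient.mk_surjective _ x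
    have hf (g : MvPolynomial σ R) : g ∈ P ↔ g * f ∈ restrictSupportIdeal R T hT := by
      rw [hx, mem_colon_bot_mk]
    refine ⟨_, toFinset_mem_assVars_of_colon_isPrime hP hf, ?_⟩
    simpa using (colon_isPrime_eq_span_X_image hP hf).symm
  · rintro ⟨S, ⟨w, hw⟩, rfl⟩
    refine isAssociatedPrime_iff.2
      ⟨isPrime_span_X_image _, Submodule.Quotient.mk (monomial w 1), ?_⟩
    ext g
    rw [mem_colon_bot_mk, colon_monomial_eq hw]

theorem isSMulRegular_quotient_restrictSupportIdeal [IsDomain R] [IsNoetherianRing R] [Finite σ]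
    {f : MvPolynomial σ R} (hf : ∀ S ∈ assVars T, f ∉ Ideal.span (X '' (S : Set σ))) :
    IsSMulRegular (MvPolynomial σ R ⧸ restrictSupportIdeal R T hT) f := by
  by_contra hreg
  have hmem : f ∈ {r | IsSMulRegular (MvPolynomial σ R ⧸ restrictSupportIdeal R T hT) r}ᶜ := hreg
  rw [← biUnion_associatedPrimes_eq_compl_regular, associatedPrimes_restrictSupportIdeal] at hmem
  simp only [Set.biUnion_image, Set.mem_iUnion] at hmem
  obtain ⟨S, hS, hfS⟩ := hmem
  exact hf S hS hfS

theorem mem_of_mem_span_X_image_of_coeff_ne_zero {S : Set σ} {f : MvPolynomial σ R}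
    (hf : f ∈ Ideal.span (X '' S)) {i : σ} (hi : f.coeff (Finsupp.single i 1) ≠ 0) : i ∈ S := by
  obtain ⟨j, hj, hne⟩ := mem_ideal_span_X_image.1 hf _ (mem_support_iff.2 hi)
  rwa [(Finsupp.single_apply_ne_zero.1 hne).1] at hj

end MonomialIdeal

section MonomialSpan

variable {ι σ τ R : Type*} [CommRing R]

/-- The ideal generated by the monomials `x ^ a i`. -/
noncomputable def monomialSpan (R : Type*) [CommRing R] (a : ι → σ →₀ ℕ) :
    Ideal (MvPolynomial σ R) :=
  Ideal.span (Set.range fun i => monomial (a i) 1)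

theorem isHomogeneous_monomialSpan (a : ι → σ →₀ ℕ) :
    (monomialSpan R a).IsHomogeneous (homogeneousSubmodule σ R) :=
  Ideal.homogeneous_span _ _ (Set.forall_mem_range.2 fun _ => ⟨_, isHomogeneous_monomial 1 rfl⟩)

theorem map_rename_monomialSpan (f : σ → τ) (a : ι → σ →₀ ℕ) :
    (monomialSpan R a).map (rename f) = monomialSpan R fun i => (a i).mapDomain f := by
  rw [monomialSpan, Ideal.map_span, ← Set.range_comp]
  simp only [Function.comp_def, rename_monomial, monomialSpan]

theorem monomialSpan_pow_le_idealOfVars {a : ι → σ →₀ ℕ} (ha : ∀ i, a i ≠ 0) {n : ℕ}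
    (hn : n ≠ 0) : monomialSpan R a ^ n ≤ idealOfVars σ R := by
  refine (Ideal.pow_le_self hn).trans (Ideal.span_le.2 (Set.forall_mem_range.2 fun i => ?_))
  obtain ⟨j, hj⟩ := Finsupp.ne_iff.1 (ha i)
  rw [idealOfVars, ← Set.image_univ]
  exact monomial_mem_span_X_image (Set.mem_univ j) hj 1

variable [Fintype ι]

/-- The exponents of the monomials in the `n`-th power of the ideal generated by the `x ^ a i`. -/
def powExps (a : ι → σ →₀ ℕ) (n : ℕ) : Set (σ →₀ ℕ) :=
  {w | ∃ e : ι → ℕ, ∑ i, e i = n ∧ ∑ i, e i • a i ≤ w}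

theorem isUpperSet_powExps (a : ι → σ →₀ ℕ) (n : ℕ) : IsUpperSet (powExps a n) :=
  fun _ _ hle ⟨e, he, hw⟩ => ⟨e, he, hw.trans hle⟩

theorem smul_mem_powExps (a : ι → σ →₀ ℕ) (n : ℕ) (i : ι) : n • a i ∈ powExps a n := by
  classical
  refine ⟨Pi.single i n, by simp, le_of_eq ?_⟩
  rw [Finset.sum_eq_single i (fun j _ hj => by simp [hj]) (by simp), Pi.single_eq_same]

theorem exists_ne_zero_of_mem_assVars_powExps {a : ι → σ →₀ ℕ} {n : ℕ} {S : Finset σ}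
    (hS : S ∈ assVars (powExps a n)) (i : ι) : ∃ j ∈ S, a i j ≠ 0 :=
  let ⟨j, hj, hne⟩ := exists_ne_zero_of_mem_assVars (isUpperSet_powExps a n) hS
    (smul_mem_powExps a n i)
  ⟨j, hj, right_ne_zero_of_smul hne⟩

theorem monomialSpan_pow_eq_span (a : ι → σ →₀ ℕ) (n : ℕ) : monomialSpan R a ^ n =
    Ideal.span ((monomial · 1) '' {w | ∃ e : ι → ℕ, ∑ i, e i = n ∧ ∑ i, e i • a i = w}) := by
  rw [monomialSpan, Ideal.span, Submodule.span_pow, ← Set.image_univ,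
    Finsupp.image_pow_eq_finsuppProd_image]
  congr 1
  ext p
  simp only [Set.mem_image, Set.mem_ofPred_eq]
  constructor
  · rintro ⟨e, ⟨he, -⟩, rfl⟩
    refine ⟨_, ⟨e, by rw [← he, Finsupp.degree_eq_sum], rfl⟩, ?_⟩
    simp [Finsupp.prod_fintype, monomial_pow, ← monomial_sum_one]
  · rintro ⟨_, ⟨e, he, rfl⟩, rfl⟩
    refine ⟨Finsupp.equivFunOnFinite.symm e,
      ⟨by simpa [Finsupp.degree_eq_sum] using he, by simp⟩, ?_⟩
    simp [Finsupp.prod_fintype, monomial_pow, ← monomial_sum_one]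

theorem monomialSpan_pow (a : ι → σ →₀ ℕ) (n : ℕ) :
    monomialSpan R a ^ n = restrictSupportIdeal R (powExps a n) (isUpperSet_powExps a n) := by
  ext p
  rw [monomialSpan_pow_eq_span, mem_ideal_span_monomial_image, mem_restrictSupportIdeal]
  simp [powExps]

theorem associatedPrimes_monomialSpan_pow [IsDomain R] [IsNoetherianRing R] [Finite σ]
    (a : ι → σ →₀ ℕ) (n : ℕ) :
    associatedPrimes (MvPolynomial σ R) (MvPolynomial σ R ⧸ monomialSpan R a ^ n) =
      (fun S : Finset σ => Ideal.span (X '' (S : Set σ))) '' assVars (powExps a n) := by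
  rw [monomialSpan_pow, associatedPrimes_restrictSupportIdeal]

theorem associatedPrimes_monomialSpan_pow_eq_iff [IsDomain R] [IsNoetherianRing R] [Finite σ]
    {a : ι → σ →₀ ℕ} {m n : ℕ} :
    associatedPrimes (MvPolynomial σ R) (MvPolynomial σ R ⧸ monomialSpan R a ^ m) =
        associatedPrimes (MvPolynomial σ R) (MvPolynomial σ R ⧸ monomialSpan R a ^ n) ↔
      assVars (powExps a m) = assVars (powExps a n) := by
  rw [associatedPrimes_monomialSpan_pow, associatedPrimes_monomialSpan_pow]
  exact (span_X_image_injective.comp Finset.coe_injective).image_injective.eq_iff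

theorem isSMulRegular_quotient_monomialSpan_pow [IsDomain R] [IsNoetherianRing R] [Finite σ]
    {a : ι → σ →₀ ℕ} {n : ℕ} {f : MvPolynomial σ R}
    (hf : ∀ S ∈ assVars (powExps a n), f ∉ Ideal.span (X '' (S : Set σ))) :
    IsSMulRegular (MvPolynomial σ R ⧸ monomialSpan R a ^ n) f := by
  rw [monomialSpan_pow]
  exact isSMulRegular_quotient_restrictSupportIdeal hf

end MonomialSpan

section LinearForm

variable {σ R : Type*} [Fintype σ] [CommRing R]

theorem sum_X_mem_idealOfVars : ∑ j, X j ∈ idealOfVars σ R :=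
  sum_mem fun j _ => Ideal.subset_span ⟨j, rfl⟩

theorem span_X_image_compl_sup_span_sum_X (i : σ) :
    Ideal.span (X '' {i}ᶜ) ⊔ Ideal.span {∑ j, X j} = idealOfVars σ R := by
  classical
  refine le_antisymm (sup_le (Ideal.span_mono (Set.image_subset_range _ _))
    ((Ideal.span_singleton_le_iff_mem _).2 sum_X_mem_idealOfVars)) (Ideal.span_le.2 ?_)
  have hX : ∀ j ≠ i, (X j : MvPolynomial σ R) ∈ Ideal.span (X '' {i}ᶜ) ⊔ Ideal.span {∑ j, X j} :=
    fun j hj => Ideal.mem_sup_left (Ideal.subset_span ⟨j, hj, rfl⟩)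
  rintro _ ⟨j, rfl⟩
  by_cases hj : j = i
  · subst hj
    have hcompl : ∑ l ∈ {j}ᶜ, X l ∈ Ideal.span (X '' {j}ᶜ) ⊔ Ideal.span {∑ l, X l} :=
      sum_mem fun l hl => hX l (by simpa using hl)
    refine (Ideal.add_mem_iff_left _ hcompl).1 ?_
    rw [← Fintype.sum_eq_add_sum_compl j X]
    exact Ideal.mem_sup_right (Ideal.mem_span_singleton_self _)
  · exact hX j hj

theorem eq_univ_of_sum_X_mem_span_X_image [Nontrivial R] {S : Set σ}
    (hS : (∑ j, X j : MvPolynomial σ R) ∈ Ideal.span (X '' S)) : S = Set.univ := by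
  classical
  refine Set.eq_univ_of_forall fun i => mem_of_mem_span_X_image_of_coeff_ne_zero hS ?_
  simp [coeff_sum, coeff_X, Finsupp.single_left_inj]

theorem depth_quotient_monomialSpan_pow_eq_one {ι : Type*} [Fintype ι] [DecidableEq σ]
    [IsDomain R] [IsNoetherianRing R] {a : ι → σ →₀ ℕ} {n : ℕ} (ha : ∀ i, a i ≠ 0) (hn : n ≠ 0)
    (huniv : Finset.univ ∉ assVars (powExps a n)) {i : σ} (hi : {i}ᶜ ∈ assVars (powExps a n)) :
    depth (idealOfVars σ R) (MvPolynomial σ R ⧸ monomialSpan R a ^ n) = 1 := by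
  have hreg : IsSMulRegular (MvPolynomial σ R ⧸ monomialSpan R a ^ n) (∑ j, X j) :=
    isSMulRegular_quotient_monomialSpan_pow fun S hS hmem => huniv <| by
      rwa [Finset.coe_eq_univ.1 (eq_univ_of_sum_X_mem_span_X_image hmem)] at hS
  have hP : Ideal.span (X '' {i}ᶜ) ∈
      associatedPrimes (MvPolynomial σ R) (MvPolynomial σ R ⧸ monomialSpan R a ^ n) := by
    rw [associatedPrimes_monomialSpan_pow]
    exact ⟨_, hi, by simp⟩
  have hsup := span_X_image_compl_sup_span_sum_X (R := R) i
  exact le_antisymm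
    (depth_le_one_of_mem_associatedPrimes hreg hP (hsup ▸ idealOfVars_ne_top) hsup.ge)
    (one_le_depth_quotient idealOfVars_ne_top (monomialSpan_pow_le_idealOfVars ha hn)
      sum_X_mem_idealOfVars hreg)

end LinearForm

theorem monomialSpan_fin_three {σ R : Type*} [CommRing R] (a : Fin 3 → σ →₀ ℕ) :
    monomialSpan R a = Ideal.span {monomial (a 0) 1, monomial (a 1) 1, monomial (a 2) 1} := by
  rw [monomialSpan]
  congr 1
  ext p
  simp [Fin.exists_fin_succ, eq_comm]

theorem mem_powExps_fin_three {σ : Type*} {a : Fin 3 → σ →₀ ℕ} {n : ℕ} {w : σ →₀ ℕ} :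
    w ∈ powExps a n ↔ ∃ i j l, i + j + l = n ∧ i • a 0 + j • a 1 + l • a 2 ≤ w := by
  simp [powExps, Fin.exists_fin_succ_pi, Fin.sum_univ_three]

/-- The exponent vector with the listed coordinates. -/
noncomputable def expVec {m : ℕ} (v : Fin m → ℕ) : Fin m →₀ ℕ :=
  Finsupp.equivFunOnFinite.symm v

@[simp]
theorem expVec_apply {m : ℕ} (v : Fin m → ℕ) (i : Fin m) : expVec v i = v i :=
  rfl

theorem monomial_expVec {R : Type*} [CommRing R] (p q r s : ℕ) :
    monomial (expVec ![p, q, r, s]) (1 : R) = X 0 ^ p * X 1 ^ q * X 2 ^ r * X 3 ^ s := by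
  simp [monomial_eq, Finsupp.prod_fintype, Fin.prod_univ_four]

section IdealI

/-- Exponents of the generators of `idealI k (d + 1)`; the shift avoids truncated subtraction. -/
noncomputable def expsI (d : ℕ) : Fin 3 → Fin 4 →₀ ℕ :=
  ![expVec ![d + 2, 0, d + 1, 0], expVec ![0, 1, 1, 2 * d + 1], expVec ![0, 0, 0, 2 * d + 3]]

theorem idealI_eq_monomialSpan (k : Type*) [Field k] (d : ℕ) :
    idealI k (d + 1) = monomialSpan k (expsI d) := by
  have hpred : 2 * (d + 1) - 1 = 2 * d + 1 := by omega
  have hsucc : 2 * (d + 1) + 1 = 2 * d + 3 := by ring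
  have hmul : (X 3 ^ (2 * d + 1) * X 1 * X 2 : MvPolynomial (Fin 4) k) =
      X 1 * X 2 * X 3 ^ (2 * d + 1) := by ring
  rw [idealI, hpred, hsucc, hmul, monomialSpan_fin_three]
  simp [expsI, monomial_expVec]

theorem expsI_ne_zero (d : ℕ) : ∀ i, expsI d i ≠ 0 := by
  simp [Fin.forall_fin_succ, expsI, DFunLike.ne_iff, Fin.exists_fin_succ]

/-- The conditions on the exponent vector of `x^p y^q z^r u^s` for this monomial to lie in
`idealI k (d + 1) ^ n`: for some `i + N = n` it is divisible by the product of the `i`-th power of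
the first generator and of `N` among the other two, whose distribution has been eliminated. -/
def PowI (d n p q r s : ℕ) : Prop :=
  ∃ i N, i + N = n ∧ (d + 2) * i ≤ p ∧ (d + 1) * i ≤ r ∧ (2 * d + 3) * N ≤ s + 2 * q ∧
    (2 * d + 3) * N + (2 * d + 2) * i ≤ s + 2 * r ∧ (2 * d + 1) * N ≤ s

theorem powI_iff {d n p q r s : ℕ} : PowI d n p q r s ↔
    ∃ i j l, i + j + l = n ∧ (d + 2) * i ≤ p ∧ j ≤ q ∧ (d + 1) * i + j ≤ r ∧
      (2 * d + 1) * j + (2 * d + 3) * l ≤ s := by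
  constructor
  · rintro ⟨i, N, rfl, hp, hr, hsq, hsr, hs⟩
    obtain ⟨r, rfl⟩ := Nat.exists_eq_add_of_le hr
    -- the least exponent of the second generator that the exponent of `u` permits
    obtain ⟨j, hsj, hj⟩ : ∃ j, (2 * d + 3) * N ≤ s + 2 * j ∧
        ∀ t, (2 * d + 3) * N ≤ s + 2 * t → j ≤ t :=
      ⟨((2 * d + 3) * N - s + 1) / 2, by omega, fun t ht => by omega⟩
    obtain ⟨l, rfl⟩ := Nat.exists_eq_add_of_le (hj N (by nlinarith))
    exact ⟨i, j, l, by omega, hp, hj q hsq, Nat.add_le_add_left (hj r (by nlinarith)) _,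
      by nlinarith⟩
  · rintro ⟨i, j, l, rfl, h1, h2, h3, h4⟩
    exact ⟨i, j + l, by omega, h1, by nlinarith, by nlinarith, by nlinarith, by nlinarith⟩

theorem mem_powExps_expsI {d n : ℕ} {w : Fin 4 →₀ ℕ} :
    w ∈ powExps (expsI d) n ↔ PowI d n (w 0) (w 1) (w 2) (w 3) := by
  simp [mem_powExps_fin_three, powI_iff, Finsupp.le_def, Fin.forall_fin_succ, expsI, mul_comm]

theorem PowI.exists_add_eq_of_lt {d n p q r s i : ℕ} (h : PowI d n p q r s)
    (hp : p < (d + 2) * (i + 1)) (hin : i ≤ n) : ∃ N, i + N = n ∧ (2 * d + 3) * N ≤ s + 2 * q ∧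
      (2 * d + 3) * N + (2 * d + 2) * i ≤ s + 2 * r ∧ (2 * d + 1) * N ≤ s := by
  obtain ⟨i', N', rfl, hp', -, hsq, hsr, hs⟩ := h
  have hle : i' ≤ i := Nat.lt_succ_iff.1 (lt_of_mul_lt_mul_left (hp'.trans_lt hp) (Nat.zero_le _))
  obtain ⟨t, rfl⟩ := Nat.exists_eq_add_of_le hle
  obtain ⟨N, rfl⟩ := Nat.exists_eq_add_of_le (show t ≤ N' by omega)
  exact ⟨N, by omega, by nlinarith, by nlinarith, by nlinarith⟩

/-- If multiplication by `x` moves a monomial into the ideal, it does so through the generators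
with exactly one more factor `x^(d+2) z^(d+1)` than the monomial admits. -/
theorem PowI.exists_eq_of_succ {d n p q r s : ℕ} (h : PowI d n (p + 1) q r s)
    (hn : ¬ PowI d n p q r s) :
    ∃ i N, i + 1 + N = n ∧ p + 1 = (d + 2) * (i + 1) ∧ (d + 1) * (i + 1) ≤ r ∧
      (2 * d + 3) * N + (2 * d + 2) * (i + 1) ≤ s + 2 * r := by
  obtain ⟨i, N, hiN, hp, hr, hsq, hsr, hs⟩ := h
  have hp' : p + 1 = (d + 2) * i := by
    by_contra hne
    exact hn ⟨i, N, hiN, by omega, hr, hsq, hsr, hs⟩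
  rcases i with _ | i
  · omega
  · exact ⟨i, N, hiN, hp', hr, hsr⟩

theorem powI_of_xyz {d n p q r s : ℕ} (hx : PowI d n (p + 1) q r s)
    (hy : PowI d n p (q + 1) r s) (hz : PowI d n p q (r + 1) s) : PowI d n p q r s := by
  by_contra hn
  obtain ⟨i, N, hiN, hp, hr, -⟩ := hx.exists_eq_of_succ hn
  obtain ⟨N₁, h1, -, hsr, hs⟩ := hy.exists_add_eq_of_lt (i := i) (by omega) (by omega)
  obtain ⟨N₂, h2, hsq, -, -⟩ := hz.exists_add_eq_of_lt (i := i) (by omega) (by omega)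
  obtain rfl : N₁ = N₂ := by omega
  exact hn ⟨i, N₁, h1, by nlinarith, by nlinarith, hsq, hsr, hs⟩

theorem lt_of_powI_xz {d n p q r s : ℕ} (hx : PowI d n (p + 1) q r s)
    (hz : PowI d n p q (r + 1) s) (hn : ¬ PowI d n p q r s) : d + 1 < n := by
  obtain ⟨i, N, hiN, hp, hr, -⟩ := hx.exists_eq_of_succ hn
  obtain ⟨N₂, h2, hsq, -, hs'⟩ := hz.exists_add_eq_of_lt (i := i) (by omega) (by omega)
  obtain rfl : N₂ = N + 1 := by omega
  have : ¬ (2 * d + 3) * (N + 1) + (2 * d + 2) * i ≤ s + 2 * r := fun h =>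
    hn ⟨i, N + 1, h2, by nlinarith, by nlinarith, hsq, h, hs'⟩
  nlinarith

theorem powI_zero_of_y {n p q r s : ℕ} (hy : PowI 0 n p (q + 1) r s) :
    PowI 0 n (p + 2 * n) q r s := by
  obtain ⟨i, N, rfl, h1, h2, h3, h4, h5⟩ := hy
  rcases le_total (i + N) r with h | h
  · exact ⟨i + N, 0, by omega, by omega, by omega, by omega, by omega, by omega⟩
  · exact ⟨r, i + N - r, by omega, by omega, by omega, by omega, by omega, by omega⟩

section AssVars

variable {d n : ℕ} {S : Finset (Fin 4)}

theorem xyz_notMem_of_mem_assVars_expsI (hS : S ∈ assVars (powExps (expsI d) n)) :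
    ¬(0 ∈ S ∧ 1 ∈ S ∧ 2 ∈ S) := by
  obtain ⟨w, hwT, hw⟩ := exists_notMem_of_mem_assVars hS
  rintro ⟨h0, h1, h2⟩
  exact hwT <| mem_powExps_expsI.2 <| powI_of_xyz
    (by simpa [mem_powExps_expsI] using hw 0 h0) (by simpa [mem_powExps_expsI] using hw 1 h1)
    (by simpa [mem_powExps_expsI] using hw 2 h2)

theorem lt_of_mem_assVars_expsI (hS : S ∈ assVars (powExps (expsI d) n)) (h0 : 0 ∈ S)
    (h2 : 2 ∈ S) : d + 1 < n := by
  obtain ⟨w, hwT, hw⟩ := exists_notMem_of_mem_assVars hS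
  exact lt_of_powI_xz (p := w 0) (q := w 1) (r := w 2) (s := w 3)
    (by simpa [mem_powExps_expsI] using hw 0 h0) (by simpa [mem_powExps_expsI] using hw 2 h2)
    (mem_powExps_expsI.not.1 hwT)

theorem x_mem_of_y_mem_of_mem_assVars_expsI_zero (hS : S ∈ assVars (powExps (expsI 0) n))
    (h1 : 1 ∈ S) : 0 ∈ S := by
  obtain ⟨w, hw, hlt⟩ := (mem_assVars_iff (isUpperSet_powExps _ _)).1 hS
  have hy : PowI 0 n (w 0) (w 1 + 1) (w 2) (w 3) := by simpa [mem_powExps_expsI] using hw 1 h1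
  obtain ⟨i, hi, hwi⟩ := hlt (w + Finsupp.single 0 (2 * n))
    (by simpa [mem_powExps_expsI] using powI_zero_of_y hy)
  rw [Finsupp.add_apply, lt_add_iff_pos_right, Nat.pos_iff_ne_zero,
    Finsupp.single_apply_ne_zero] at hwi
  exact hwi.1 ▸ hi

theorem xyu_mem_assVars_expsI (hn : 1 ≤ n) : {0, 1, 3} ∈ assVars (powExps (expsI d) n) := by
  obtain ⟨n, rfl⟩ := Nat.exists_eq_add_of_le' hn
  refine (mem_assVars_iff (isUpperSet_powExps _ _)).2
    ⟨expVec ![(d + 2) * n + d + 1, 0, (2 * d + 3) * (n + 1), 2 * d + 2], ?_, fun v hv => ?_⟩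
  · suffices h : PowI d (n + 1) ((d + 2) * n + d + 1 + 1) 0 ((2 * d + 3) * (n + 1)) (2 * d + 2) ∧
        PowI d (n + 1) ((d + 2) * n + d + 1) 1 ((2 * d + 3) * (n + 1)) (2 * d + 2) ∧
        PowI d (n + 1) ((d + 2) * n + d + 1) 0 ((2 * d + 3) * (n + 1)) (2 * d + 2 + 1) by
      simpa [mem_powExps_expsI] using h
    exact ⟨⟨n + 1, 0, by omega, by nlinarith, by nlinarith, by omega, by nlinarith, by omega⟩,
      ⟨n, 1, by omega, by omega, by nlinarith, by omega, by nlinarith, by omega⟩,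
      ⟨n, 1, by omega, by omega, by nlinarith, by omega, by nlinarith, by omega⟩⟩
  · obtain ⟨i, N, hiN, m1, -, m3, -, -⟩ := mem_powExps_expsI.1 hv
    by_contra! h
    obtain ⟨h0, h1, h3⟩ : v 0 ≤ (d + 2) * n + d + 1 ∧ v 1 = 0 ∧ v 3 ≤ 2 * d + 2 := by
      simpa using h
    have : i < n + 1 := lt_of_mul_lt_mul_left (a := d + 2) (by nlinarith) (Nat.zero_le _)
    nlinarith

theorem xu_mem_assVars_expsI (hn : 1 ≤ n) : {0, 3} ∈ assVars (powExps (expsI d) n) := by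
  obtain ⟨n, rfl⟩ := Nat.exists_eq_add_of_le' hn
  refine (mem_assVars_iff (isUpperSet_powExps _ _)).2
    ⟨expVec ![(d + 2) * n + d + 1, 2 * d + 3, (2 * d + 3) * (n + 1), 2 * d], ?_, fun v hv => ?_⟩
  · suffices h : PowI d (n + 1) ((d + 2) * n + d + 1 + 1) (2 * d + 3) ((2 * d + 3) * (n + 1))
          (2 * d) ∧
        PowI d (n + 1) ((d + 2) * n + d + 1) (2 * d + 3) ((2 * d + 3) * (n + 1)) (2 * d + 1) by
      simpa [mem_powExps_expsI] using h
    exact ⟨⟨n + 1, 0, by omega, by nlinarith, by nlinarith, by omega, by nlinarith, by omega⟩,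
      ⟨n, 1, by omega, by omega, by nlinarith, by omega, by nlinarith, by omega⟩⟩
  · obtain ⟨i, N, hiN, m1, -, -, -, m5⟩ := mem_powExps_expsI.1 hv
    by_contra! h
    obtain ⟨h0, h3⟩ : v 0 ≤ (d + 2) * n + d + 1 ∧ v 3 ≤ 2 * d := by simpa using h
    have : i < n + 1 := lt_of_mul_lt_mul_left (a := d + 2) (by nlinarith) (Nat.zero_le _)
    nlinarith

theorem zu_mem_assVars_expsI (hn : 1 ≤ n) : {2, 3} ∈ assVars (powExps (expsI d) n) := by
  obtain ⟨n, rfl⟩ := Nat.exists_eq_add_of_le' hn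
  obtain ⟨t, ht1, ht2, ht3⟩ : ∃ t, 2 * d ≤ t ∧ 2 ≤ t ∧ (t ≤ 2 ∨ t ≤ 2 * d) :=
    ⟨max 2 (2 * d), by omega, by omega, by omega⟩
  refine (mem_assVars_iff (isUpperSet_powExps _ _)).2
    ⟨expVec ![(d + 2) * (n + 1), 2 * d + 3, (d + 1) * n + d, t], ?_, fun v hv => ?_⟩
  · suffices h : PowI d (n + 1) ((d + 2) * (n + 1)) (2 * d + 3) ((d + 1) * n + d + 1) t ∧
        PowI d (n + 1) ((d + 2) * (n + 1)) (2 * d + 3) ((d + 1) * n + d) (t + 1) by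
      simpa [mem_powExps_expsI] using h
    exact ⟨⟨n + 1, 0, by omega, by nlinarith, by nlinarith, by omega, by nlinarith, by omega⟩,
      ⟨n, 1, by omega, by nlinarith, by nlinarith, by omega, by nlinarith, by omega⟩⟩
  · obtain ⟨i, N, hiN, -, m2, m3, m4, m5⟩ := mem_powExps_expsI.1 hv
    by_contra! h
    obtain ⟨h2, h3⟩ : v 2 ≤ (d + 1) * n + d ∧ v 3 ≤ t := by simpa using h
    have hi : i < n + 1 := lt_of_mul_lt_mul_left (a := d + 1) (by nlinarith) (Nat.zero_le _)
    obtain ⟨e, rfl⟩ := Nat.exists_eq_add_of_le (Nat.lt_succ_iff.1 hi)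
    obtain rfl : N = e + 1 := by omega
    rcases ht3 with ht | ht <;> nlinarith

theorem xzu_mem_assVars_expsI (hn : d + 2 ≤ n) : {0, 2, 3} ∈ assVars (powExps (expsI d) n) := by
  obtain ⟨n, rfl⟩ := Nat.exists_eq_add_of_le' (show 1 ≤ n by omega)
  refine (mem_assVars_iff (isUpperSet_powExps _ _)).2
    ⟨expVec ![d + 1, 2 * d + 3, d + 1, (2 * d + 3) * n], ?_, fun v hv => ?_⟩
  · suffices h : PowI d (n + 1) (d + 1 + 1) (2 * d + 3) (d + 1) ((2 * d + 3) * n) ∧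
        PowI d (n + 1) (d + 1) (2 * d + 3) (d + 1 + 1) ((2 * d + 3) * n) ∧
        PowI d (n + 1) (d + 1) (2 * d + 3) (d + 1) ((2 * d + 3) * n + 1) by
      simpa [mem_powExps_expsI] using h
    exact ⟨⟨1, n, by omega, by omega, by omega, by omega, by omega, by nlinarith⟩,
      ⟨0, n + 1, by omega, by omega, by omega, by nlinarith, by nlinarith, by nlinarith⟩,
      ⟨0, n + 1, by omega, by omega, by omega, by nlinarith, by nlinarith, by nlinarith⟩⟩
  · obtain ⟨i, N, hiN, m1, m2, m3, m4, m5⟩ := mem_powExps_expsI.1 hv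
    by_contra! h
    obtain ⟨h0, h2, h3⟩ : v 0 ≤ d + 1 ∧ v 2 ≤ d + 1 ∧ v 3 ≤ (2 * d + 3) * n := by simpa using h
    have hi : i < 1 := lt_of_mul_lt_mul_left (a := d + 2) (by omega) (Nat.zero_le _)
    obtain rfl : i = 0 := by omega
    obtain rfl : N = n + 1 := by omega
    nlinarith

theorem yzu_mem_assVars_expsI (hd : 1 ≤ d) (hn : 1 ≤ n) :
    {1, 2, 3} ∈ assVars (powExps (expsI d) n) := by
  obtain ⟨n, rfl⟩ := Nat.exists_eq_add_of_le' hn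
  refine (mem_assVars_iff (isUpperSet_powExps _ _)).2
    ⟨expVec ![(d + 2) * (n + 1), 0, (d + 1) * n + d, 2 * d + 2], ?_, fun v hv => ?_⟩
  · suffices h : PowI d (n + 1) ((d + 2) * (n + 1)) 1 ((d + 1) * n + d) (2 * d + 2) ∧
        PowI d (n + 1) ((d + 2) * (n + 1)) 0 ((d + 1) * n + d + 1) (2 * d + 2) ∧
        PowI d (n + 1) ((d + 2) * (n + 1)) 0 ((d + 1) * n + d) (2 * d + 2 + 1) by
      simpa [mem_powExps_expsI] using h
    exact ⟨⟨n, 1, by omega, by nlinarith, by nlinarith, by omega, by nlinarith, by omega⟩,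
      ⟨n + 1, 0, by omega, by nlinarith, by nlinarith, by omega, by nlinarith, by omega⟩,
      ⟨n, 1, by omega, by nlinarith, by nlinarith, by omega, by nlinarith, by omega⟩⟩
  · obtain ⟨i, N, hiN, -, m2, m3, -, -⟩ := mem_powExps_expsI.1 hv
    by_contra! h
    obtain ⟨h1, h2, h3⟩ : v 1 = 0 ∧ v 2 ≤ (d + 1) * n + d ∧ v 3 ≤ 2 * d + 2 := by simpa using h
    have hi : i < n + 1 := lt_of_mul_lt_mul_left (a := d + 1) (by nlinarith) (Nat.zero_le _)
    nlinarith

theorem mem_assVars_expsI_iff (hn : d + 2 ≤ n) : S ∈ assVars (powExps (expsI d) n) ↔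
    S = {0, 3} ∨ S = {2, 3} ∨ S = {0, 1, 3} ∨ S = {0, 2, 3} ∨ S = {1, 2, 3} ∧ 1 ≤ d := by
  constructor
  · intro hS
    have h3 : 3 ∈ S := by
      simpa [Fin.exists_fin_succ, expsI] using exists_ne_zero_of_mem_assVars_powExps hS 2
    have h02 : 0 ∈ S ∨ 2 ∈ S := by
      simpa [Fin.exists_fin_succ, expsI] using exists_ne_zero_of_mem_assVars_powExps hS 0
    have h012 := xyz_notMem_of_mem_assVars_expsI hS
    have hd : 1 ∈ S → 0 ∉ S → 1 ≤ d := fun h1 h0 => Nat.one_le_iff_ne_zero.2 fun h => by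
      subst h
      exact h0 (x_mem_of_y_mem_of_mem_assVars_expsI_zero hS h1)
    have hcases : ∀ S : Finset (Fin 4), 3 ∈ S → (0 ∈ S ∨ 2 ∈ S) → ¬(0 ∈ S ∧ 1 ∈ S ∧ 2 ∈ S) →
        S = {0, 3} ∨ S = {2, 3} ∨ S = {0, 1, 3} ∨ S = {0, 2, 3} ∨
          S = {1, 2, 3} ∧ 1 ∈ S ∧ 0 ∉ S := by decide
    have := hcases S h3 h02 h012
    tauto
  · have hn1 : 1 ≤ n := by omega
    rintro (rfl | rfl | rfl | rfl | ⟨rfl, hd⟩)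
    exacts [xu_mem_assVars_expsI hn1, zu_mem_assVars_expsI hn1, xyu_mem_assVars_expsI hn1,
      xzu_mem_assVars_expsI hn, yzu_mem_assVars_expsI hd hn1]

end AssVars

variable (k : Type*) [Field k] (d : ℕ)

theorem isHomogeneous_idealI :
    (idealI k (d + 1)).IsHomogeneous (homogeneousSubmodule (Fin 4) k) :=
  idealI_eq_monomialSpan k d ▸ isHomogeneous_monomialSpan _

theorem isAstab_idealI : IsAstab (idealI k (d + 1)) (d + 2) := by
  rw [idealI_eq_monomialSpan]
  refine ⟨⟨by omega, fun n hn => ?_⟩, fun a ⟨_, h⟩ => ?_⟩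
  · rw [associatedPrimes_monomialSpan_pow_eq_iff]
    ext S
    rw [mem_assVars_expsI_iff hn, mem_assVars_expsI_iff le_rfl]
  · by_contra! hlt
    have heq := (h (d + 2) (by omega)).trans (h (d + 1) (by omega)).symm
    rw [associatedPrimes_monomialSpan_pow_eq_iff] at heq
    exact lt_irrefl _ (lt_of_mem_assVars_expsI (heq ▸ xzu_mem_assVars_expsI le_rfl)
      (by simp) (by simp))

theorem isDstab_idealI : IsDstab (idealOfVars (Fin 4) k) (idealI k (d + 1)) 1 := by
  rw [idealI_eq_monomialSpan]
  have hdepth (n : ℕ) (hn : 1 ≤ n) : depth (idealOfVars (Fin 4) k)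
      (MvPolynomial (Fin 4) k ⧸ monomialSpan k (expsI d) ^ n) = 1 := by
    refine depth_quotient_monomialSpan_pow_eq_one (expsI_ne_zero d) (by omega)
      (fun h => xyz_notMem_of_mem_assVars_expsI h (by simp)) (i := 2) ?_
    rw [show ({2}ᶜ : Finset (Fin 4)) = {0, 1, 3} by decide]
    exact xyu_mem_assVars_expsI hn
  exact ⟨⟨le_rfl, fun n hn => by rw [hdepth n hn, hdepth 1 le_rfl]⟩, fun _ => And.left⟩

end IdealI

section IdealJ

/-- Exponents of the generators of `idealJ k (d + 2)`; the shift avoids truncated subtraction. -/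
noncomputable def expsJ (d : ℕ) : Fin 3 → Fin 4 →₀ ℕ :=
  ![expVec ![d + 2, d + 1, 0, 0], expVec ![d + 1, d + 1, 1, 0], expVec ![0, 0, d + 2, d + 2]]

theorem idealJ_eq_monomialSpan (k : Type*) [Field k] (d : ℕ) :
    idealJ k (d + 2) = monomialSpan k (expsJ d) := by
  simp [idealJ, monomialSpan_fin_three, expsJ, monomial_expVec]

theorem expsJ_ne_zero (d : ℕ) : ∀ i, expsJ d i ≠ 0 := by
  simp [Fin.forall_fin_succ, expsJ, DFunLike.ne_iff, Fin.exists_fin_succ]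

/-- The conditions on the exponent vector of `x^p y^q z^r u^s` for this monomial to lie in
`idealJ k (d + 2) ^ n`: it is divisible by a product of the `l`-th power of the last generator and
of `N` among the first two, whose distribution has been eliminated. -/
def PowJ (d n p q r s : ℕ) : Prop :=
  (d + 2) * n ≤ p + r ∧ ∃ l N, l + N = n ∧ (d + 1) * N ≤ p ∧ (d + 1) * N ≤ q ∧
    (d + 2) * l ≤ r ∧ (d + 2) * l ≤ s

theorem powJ_iff {d n p q r s : ℕ} : PowJ d n p q r s ↔
    ∃ i j l, i + j + l = n ∧ (d + 2) * i + (d + 1) * j ≤ p ∧ (d + 1) * i + (d + 1) * j ≤ q ∧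
      j + (d + 2) * l ≤ r ∧ (d + 2) * l ≤ s := by
  constructor
  · rintro ⟨h, l, N, rfl, h1, h2, h3, h4⟩
    rcases le_total (N + (d + 2) * l) r with hr | hr
    · exact ⟨0, N, l, by omega, by omega, by omega, by omega, h4⟩
    · obtain ⟨i, hi⟩ := Nat.exists_eq_add_of_le hr
      obtain ⟨j, rfl⟩ := Nat.exists_eq_add_of_le (show i ≤ N by omega)
      exact ⟨i, j, l, by omega, by nlinarith, by nlinarith, by omega, h4⟩
  · rintro ⟨i, j, l, rfl, h1, h2, h3, h4⟩
    exact ⟨by nlinarith, l, i + j, by omega, by nlinarith, by nlinarith, by nlinarith, h4⟩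

theorem mem_powExps_expsJ {d n : ℕ} {w : Fin 4 →₀ ℕ} :
    w ∈ powExps (expsJ d) n ↔ PowJ d n (w 0) (w 1) (w 2) (w 3) := by
  simp [mem_powExps_fin_three, powJ_iff, Finsupp.le_def, Fin.forall_fin_succ, expsJ, mul_comm]

theorem powJ_of_xy {d n p q r s : ℕ} (hx : PowJ d n (p + 1) q r s)
    (hy : PowJ d n p (q + 1) r s) : PowJ d n p q r s := by
  obtain ⟨-, l, N, rfl, -, h2, h3, h4⟩ := hx
  obtain ⟨h, l', N', hn, h1', -, h3', h4'⟩ := hy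
  refine ⟨h, ?_⟩
  rcases le_total p q with hpq | hpq
  · exact ⟨l', N', hn, h1', h1'.trans hpq, h3', h4'⟩
  · exact ⟨l, N, rfl, h2.trans hpq, h2, h3, h4⟩

theorem powJ_of_zu {d n p q r s : ℕ} (hz : PowJ d n p q (r + 1) s)
    (hu : PowJ d n p q r (s + 1)) : PowJ d n p q r s := by
  obtain ⟨-, l, N, rfl, h1, h2, -, h4⟩ := hz
  obtain ⟨h, l', N', hn, h1', h2', h3', -⟩ := hu
  refine ⟨h, ?_⟩
  rcases le_total r s with hrs | hrs
  · exact ⟨l', N', hn, h1', h2', h3', h3'.trans hrs⟩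
  · exact ⟨l, N, rfl, h1, h2, h4.trans hrs, h4⟩

section AssVars

variable {d n : ℕ} {S : Finset (Fin 4)}

theorem xy_notMem_of_mem_assVars_expsJ (hS : S ∈ assVars (powExps (expsJ d) n)) :
    ¬(0 ∈ S ∧ 1 ∈ S) := by
  obtain ⟨w, hwT, hw⟩ := exists_notMem_of_mem_assVars hS
  rintro ⟨h0, h1⟩
  exact hwT <| mem_powExps_expsJ.2 <| powJ_of_xy
    (by simpa [mem_powExps_expsJ] using hw 0 h0) (by simpa [mem_powExps_expsJ] using hw 1 h1)

theorem zu_notMem_of_mem_assVars_expsJ (hS : S ∈ assVars (powExps (expsJ d) n)) :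
    ¬(2 ∈ S ∧ 3 ∈ S) := by
  obtain ⟨w, hwT, hw⟩ := exists_notMem_of_mem_assVars hS
  rintro ⟨h2, h3⟩
  exact hwT <| mem_powExps_expsJ.2 <| powJ_of_zu
    (by simpa [mem_powExps_expsJ] using hw 2 h2) (by simpa [mem_powExps_expsJ] using hw 3 h3)

theorem xz_mem_assVars_expsJ (hn : 1 ≤ n) : {0, 2} ∈ assVars (powExps (expsJ d) n) := by
  obtain ⟨n, rfl⟩ := Nat.exists_eq_add_of_le' hn
  refine (mem_assVars_iff (isUpperSet_powExps _ _)).2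
    ⟨expVec ![(d + 1) * (n + 1), (d + 1) * (n + 1), n, 0], ?_, fun v hv => ?_⟩
  · suffices h : PowJ d (n + 1) ((d + 1) * (n + 1) + 1) ((d + 1) * (n + 1)) n 0 ∧
        PowJ d (n + 1) ((d + 1) * (n + 1)) ((d + 1) * (n + 1)) (n + 1) 0 by
      simpa [mem_powExps_expsJ] using h
    exact ⟨⟨by nlinarith, 0, n + 1, by omega, by omega, by omega, by omega, by omega⟩,
      ⟨by nlinarith, 0, n + 1, by omega, by omega, by omega, by omega, by omega⟩⟩
  · obtain ⟨hpr, -⟩ := mem_powExps_expsJ.1 hv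
    by_contra! h
    obtain ⟨h0, h2⟩ : v 0 ≤ (d + 1) * (n + 1) ∧ v 2 ≤ n := by simpa using h
    nlinarith

theorem xu_mem_assVars_expsJ (hn : 1 ≤ n) : {0, 3} ∈ assVars (powExps (expsJ d) n) := by
  obtain ⟨n, rfl⟩ := Nat.exists_eq_add_of_le' hn
  refine (mem_assVars_iff (isUpperSet_powExps _ _)).2
    ⟨expVec ![(d + 1) * n + d, (d + 1) * (n + 1), (d + 2) * (n + 1), d + 1], ?_, fun v hv => ?_⟩
  · suffices h : PowJ d (n + 1) ((d + 1) * n + d + 1) ((d + 1) * (n + 1)) ((d + 2) * (n + 1))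
          (d + 1) ∧
        PowJ d (n + 1) ((d + 1) * n + d) ((d + 1) * (n + 1)) ((d + 2) * (n + 1)) (d + 1 + 1) by
      simpa [mem_powExps_expsJ] using h
    exact ⟨⟨by nlinarith, 0, n + 1, by omega, by nlinarith, by omega, by omega, by omega⟩,
      ⟨by nlinarith, 1, n, by omega, by nlinarith, by nlinarith, by nlinarith, by omega⟩⟩
  · obtain ⟨-, l, N, hlN, m1, -, -, m4⟩ := mem_powExps_expsJ.1 hv
    by_contra! h
    obtain ⟨h0, h3⟩ : v 0 ≤ (d + 1) * n + d ∧ v 3 ≤ d + 1 := by simpa using h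
    have : N < n + 1 := lt_of_mul_lt_mul_left (a := d + 1) (by nlinarith) (Nat.zero_le _)
    nlinarith

theorem yz_mem_assVars_expsJ (hn : 1 ≤ n) : {1, 2} ∈ assVars (powExps (expsJ d) n) := by
  obtain ⟨n, rfl⟩ := Nat.exists_eq_add_of_le' hn
  refine (mem_assVars_iff (isUpperSet_powExps _ _)).2
    ⟨expVec ![(d + 2) * (n + 1), (d + 1) * n + d, d + 1, (d + 2) * (n + 1)], ?_, fun v hv => ?_⟩
  · suffices h : PowJ d (n + 1) ((d + 2) * (n + 1)) ((d + 1) * n + d + 1) (d + 1)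
          ((d + 2) * (n + 1)) ∧
        PowJ d (n + 1) ((d + 2) * (n + 1)) ((d + 1) * n + d) (d + 1 + 1) ((d + 2) * (n + 1)) by
      simpa [mem_powExps_expsJ] using h
    exact ⟨⟨by nlinarith, 0, n + 1, by omega, by nlinarith, by nlinarith, by omega, by omega⟩,
      ⟨by nlinarith, 1, n, by omega, by nlinarith, by nlinarith, by omega, by nlinarith⟩⟩
  · obtain ⟨-, l, N, hlN, -, m2, m3, -⟩ := mem_powExps_expsJ.1 hv
    by_contra! h
    obtain ⟨h1, h2⟩ : v 1 ≤ (d + 1) * n + d ∧ v 2 ≤ d + 1 := by simpa using h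
    have : N < n + 1 := lt_of_mul_lt_mul_left (a := d + 1) (by nlinarith) (Nat.zero_le _)
    nlinarith

theorem yu_mem_assVars_expsJ (hn : 1 ≤ n) : {1, 3} ∈ assVars (powExps (expsJ d) n) := by
  obtain ⟨n, rfl⟩ := Nat.exists_eq_add_of_le' hn
  refine (mem_assVars_iff (isUpperSet_powExps _ _)).2
    ⟨expVec ![(d + 2) * (n + 1), (d + 1) * n + d, (d + 2) * (n + 1), d + 1], ?_, fun v hv => ?_⟩
  · suffices h : PowJ d (n + 1) ((d + 2) * (n + 1)) ((d + 1) * n + d + 1) ((d + 2) * (n + 1))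
          (d + 1) ∧
        PowJ d (n + 1) ((d + 2) * (n + 1)) ((d + 1) * n + d) ((d + 2) * (n + 1)) (d + 1 + 1) by
      simpa [mem_powExps_expsJ] using h
    exact ⟨⟨by nlinarith, 0, n + 1, by omega, by nlinarith, by nlinarith, by omega, by omega⟩,
      ⟨by nlinarith, 1, n, by omega, by nlinarith, by nlinarith, by nlinarith, by omega⟩⟩
  · obtain ⟨-, l, N, hlN, -, m2, -, m4⟩ := mem_powExps_expsJ.1 hv
    by_contra! h
    obtain ⟨h1, h3⟩ : v 1 ≤ (d + 1) * n + d ∧ v 3 ≤ d + 1 := by simpa using h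
    have : N < n + 1 := lt_of_mul_lt_mul_left (a := d + 1) (by nlinarith) (Nat.zero_le _)
    nlinarith

theorem mem_assVars_expsJ_iff (hn : 1 ≤ n) : S ∈ assVars (powExps (expsJ d) n) ↔
    S = {0, 2} ∨ S = {0, 3} ∨ S = {1, 2} ∨ S = {1, 3} := by
  constructor
  · intro hS
    have h01 : 0 ∈ S ∨ 1 ∈ S := by
      simpa [Fin.exists_fin_succ, expsJ] using exists_ne_zero_of_mem_assVars_powExps hS 0
    have h23 : 2 ∈ S ∨ 3 ∈ S := by
      simpa [Fin.exists_fin_succ, expsJ] using exists_ne_zero_of_mem_assVars_powExps hS 2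
    have hcases : ∀ S : Finset (Fin 4), (0 ∈ S ∨ 1 ∈ S) → (2 ∈ S ∨ 3 ∈ S) → ¬(0 ∈ S ∧ 1 ∈ S) →
        ¬(2 ∈ S ∧ 3 ∈ S) → S = {0, 2} ∨ S = {0, 3} ∨ S = {1, 2} ∨ S = {1, 3} := by decide
    exact hcases S h01 h23 (xy_notMem_of_mem_assVars_expsJ hS) (zu_notMem_of_mem_assVars_expsJ hS)
  · rintro (rfl | rfl | rfl | rfl)
    exacts [xz_mem_assVars_expsJ hn, xu_mem_assVars_expsJ hn, yz_mem_assVars_expsJ hn,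
      yu_mem_assVars_expsJ hn]

end AssVars

/-- The specialization `y ↦ x`, as a map `k[x,y,z,u] → k[x,z,u]`. -/
noncomputable def specializeXY (R : Type*) [CommRing R] :
    MvPolynomial (Fin 4) R →+* MvPolynomial (Fin 3) R :=
  (rename ![0, 0, 1, 2] : MvPolynomial (Fin 4) R →ₐ[R] MvPolynomial (Fin 3) R)

@[simp]
theorem specializeXY_X {R : Type*} [CommRing R] (i : Fin 4) :
    specializeXY R (X i) = X (![0, 0, 1, 2] i) :=
  rename_X _ _

theorem specializeXY_surjective {R : Type*} [CommRing R] :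
    Function.Surjective (specializeXY R) :=
  rename_surjective _ fun i => by fin_cases i <;> simp [Fin.exists_fin_succ]

theorem ker_specializeXY {R : Type*} [CommRing R] :
    RingHom.ker (specializeXY R) = Ideal.span {X 0 - X 1} := by
  refine le_antisymm (fun p hp => ?_) ((Ideal.span_singleton_le_iff_mem _).2 (by simp))
  have hX (i : Fin 4) : (X (![0, 2, 3] (![0, 0, 1, 2] i)) - X i : MvPolynomial (Fin 4) R) ∈
      Ideal.span {X 0 - X 1} := by
    fin_cases i <;> simp
  have h : aeval ((fun j => X (![0, 2, 3] j)) ∘ ![0, 0, 1, 2]) p - p ∈ Ideal.span {X 0 - X 1} :=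
    aeval_sub_self_mem hX p
  have hp0 : rename ![0, 0, 1, 2] p = (0 : MvPolynomial (Fin 3) R) := hp
  rwa [← aeval_rename, hp0, map_zero, zero_sub, neg_mem_iff] at h

/-- The images of the exponents `expsJ` under the specialization `y ↦ x`. -/
noncomputable def expsK (d : ℕ) : Fin 3 → Fin 3 →₀ ℕ :=
  ![expVec ![2 * d + 3, 0, 0], expVec ![2 * d + 2, 1, 0], expVec ![0, d + 2, d + 2]]

theorem map_specializeXY_monomialSpan_expsJ_pow (R : Type*) [CommRing R] (d n : ℕ) :
    (monomialSpan R (expsJ d) ^ n).map (specializeXY R) = monomialSpan R (expsK d) ^ n := by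
  have hexp : (fun i => (expsJ d i).mapDomain ![0, 0, 1, 2]) = expsK d := by
    ext i j
    fin_cases i <;> fin_cases j <;>
      simp [expsJ, expsK, Finsupp.mapDomain, Finsupp.sum_fintype, Fin.sum_univ_four] <;>
      omega
  rw [Ideal.map_pow, ← hexp, ← map_rename_monomialSpan]
  rfl

/-- The conditions on the exponent vector of `x^p z^r u^s` for this monomial to lie in the `n`-th
power of the ideal with exponents `expsK d`: it is divisible by a product of the `l`-th power of
the last generator and of `N` among the first two, whose distribution has been eliminated. -/
def PowK (d n p r s : ℕ) : Prop :=
  ∃ l N, l + N = n ∧ (2 * d + 2) * N ≤ p ∧ (d + 2) * l ≤ r ∧ (d + 2) * l ≤ s ∧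
    (2 * d + 3) * N + (d + 2) * l ≤ p + r

theorem powK_iff {d n p r s : ℕ} : PowK d n p r s ↔
    ∃ i j l, i + j + l = n ∧ (2 * d + 3) * i + (2 * d + 2) * j ≤ p ∧
      j + (d + 2) * l ≤ r ∧ (d + 2) * l ≤ s := by
  constructor
  · rintro ⟨l, N, rfl, h1, h2, h3, h4⟩
    rcases le_total (N + (d + 2) * l) r with hr | hr
    · exact ⟨0, N, l, by omega, by omega, by omega, h3⟩
    · obtain ⟨i, hi⟩ := Nat.exists_eq_add_of_le hr
      obtain ⟨j, rfl⟩ := Nat.exists_eq_add_of_le (show i ≤ N by omega)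
      exact ⟨i, j, l, by omega, by nlinarith, by omega, h3⟩
  · rintro ⟨i, j, l, rfl, h1, h2, h3⟩
    exact ⟨l, i + j, by omega, by nlinarith, by nlinarith, by nlinarith, by nlinarith⟩

theorem mem_powExps_expsK {d n : ℕ} {w : Fin 3 →₀ ℕ} :
    w ∈ powExps (expsK d) n ↔ PowK d n (w 0) (w 1) (w 2) := by
  simp [mem_powExps_fin_three, powK_iff, Finsupp.le_def, Fin.forall_fin_succ, expsK, mul_comm]

theorem PowK.exists_add_eq_of_lt {d n p r s l : ℕ} (h : PowK d n p r s)
    (hl : s < (d + 2) * (l + 1)) (hln : l ≤ n) : ∃ N, l + N = n ∧ (2 * d + 2) * N ≤ p ∧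
    (2 * d + 3) * N + (d + 2) * l ≤ p + r := by
  obtain ⟨l', N', rfl, hp, -, hs, hpr⟩ := h
  have hle : l' ≤ l := Nat.lt_succ_iff.1 (lt_of_mul_lt_mul_left (hs.trans_lt hl) (Nat.zero_le _))
  obtain ⟨t, rfl⟩ := Nat.exists_eq_add_of_le hle
  obtain ⟨N, rfl⟩ := Nat.exists_eq_add_of_le (show t ≤ N' by omega)
  exact ⟨N, by omega, by nlinarith, by nlinarith⟩

theorem lt_of_powK_xzu {d n p r s : ℕ} (hx : PowK d n (p + 1) r s) (hz : PowK d n p (r + 1) s)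
    (hu : PowK d n p r (s + 1)) (hn : ¬ PowK d n p r s) : d + 2 < n := by
  obtain ⟨l, N, rfl, h1, h2, h3, h4⟩ := hu
  have hs : s + 1 = (d + 2) * l := by
    by_contra hne
    exact hn ⟨l, N, rfl, h1, h2, by omega, h4⟩
  rcases l with _ | l
  · omega
  obtain ⟨N₁, e1, -, hx2⟩ := hx.exists_add_eq_of_lt (l := l) (by omega) (by omega)
  obtain ⟨N₂, e2, hz1, -⟩ := hz.exists_add_eq_of_lt (l := l) (by omega) (by omega)
  obtain rfl : N₁ = N + 1 := by omega
  obtain rfl : N₂ = N + 1 := by omega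
  have : ¬ (2 * d + 3) * (N + 1) + (d + 2) * l ≤ p + r := fun h =>
    hn ⟨l, N + 1, e1, hz1, by nlinarith, by nlinarith, h⟩
  nlinarith

theorem lt_of_mem_assVars_expsK {d n : ℕ} {S : Finset (Fin 3)}
    (hS : S ∈ assVars (powExps (expsK d) n)) (h1 : 1 ∈ S) (h2 : 2 ∈ S) : d + 2 < n := by
  have h0 : 0 ∈ S := by
    simpa [Fin.exists_fin_succ, expsK] using exists_ne_zero_of_mem_assVars_powExps hS 0
  obtain ⟨w, hwT, hw⟩ := exists_notMem_of_mem_assVars hS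
  exact lt_of_powK_xzu (p := w 0) (r := w 1) (s := w 2)
    (by simpa [mem_powExps_expsK] using hw 0 h0) (by simpa [mem_powExps_expsK] using hw 1 h1)
    (by simpa [mem_powExps_expsK] using hw 2 h2) (mem_powExps_expsK.not.1 hwT)

theorem univ_mem_assVars_expsK {d n : ℕ} (hn : d + 3 ≤ n) :
    Finset.univ ∈ assVars (powExps (expsK d) n) := by
  obtain ⟨n, rfl⟩ := Nat.exists_eq_add_of_le' (show 1 ≤ n by omega)
  refine (mem_assVars_iff (isUpperSet_powExps _ _)).2
    ⟨expVec ![(2 * d + 2) * (n + 1), n, d + 1], ?_, fun v hv => ?_⟩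
  · suffices h : PowK d (n + 1) ((2 * d + 2) * (n + 1) + 1) n (d + 1) ∧
        PowK d (n + 1) ((2 * d + 2) * (n + 1)) (n + 1) (d + 1) ∧
        PowK d (n + 1) ((2 * d + 2) * (n + 1)) n (d + 1 + 1) by
      simpa [mem_powExps_expsK, Fin.forall_fin_succ] using h
    exact ⟨⟨0, n + 1, by omega, by omega, by omega, by omega, by nlinarith⟩,
      ⟨0, n + 1, by omega, by omega, by omega, by omega, by nlinarith⟩,
      ⟨1, n, by omega, by nlinarith, by omega, by omega, by nlinarith⟩⟩
  · obtain ⟨l, N, hlN, m1, m2, m3, m4⟩ := mem_powExps_expsK.1 hv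
    by_contra! h
    obtain ⟨h0, h1, h2⟩ : v 0 ≤ (2 * d + 2) * (n + 1) ∧ v 1 ≤ n ∧ v 2 ≤ d + 1 := by
      simpa [Fin.forall_fin_succ] using h
    have hl : l < 1 := lt_of_mul_lt_mul_left (a := d + 2) (by omega) (Nat.zero_le _)
    obtain rfl : l = 0 := by omega
    obtain rfl : N = n + 1 := by omega
    nlinarith

variable (k : Type*) [Field k] (d : ℕ)

theorem isHomogeneous_idealJ :
    (idealJ k (d + 2)).IsHomogeneous (homogeneousSubmodule (Fin 4) k) :=
  idealJ_eq_monomialSpan k d ▸ isHomogeneous_monomialSpan _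

theorem isAstab_idealJ : IsAstab (idealJ k (d + 2)) 1 := by
  rw [idealJ_eq_monomialSpan]
  refine ⟨⟨le_rfl, fun n hn => ?_⟩, fun _ => And.left⟩
  rw [associatedPrimes_monomialSpan_pow_eq_iff]
  ext S
  rw [mem_assVars_expsJ_iff hn, mem_assVars_expsJ_iff le_rfl]

theorem isSMulRegular_X_zero_sub_X_one (n : ℕ) :
    IsSMulRegular (MvPolynomial (Fin 4) k ⧸ monomialSpan k (expsJ d) ^ n)
      (X 0 - X 1 : MvPolynomial (Fin 4) k) := by
  refine isSMulRegular_quotient_monomialSpan_pow fun S hS hmem => ?_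
  refine xy_notMem_of_mem_assVars_expsJ hS ⟨mem_of_mem_span_X_image_of_coeff_ne_zero hmem ?_,
    mem_of_mem_span_X_image_of_coeff_ne_zero hmem ?_⟩ <;>
  simp [coeff_X, Finsupp.single_left_inj]

theorem isSMulRegular_X_one_sub_X_two {n : ℕ} (hn : n ≤ d + 2) :
    IsSMulRegular (MvPolynomial (Fin 3) k ⧸ monomialSpan k (expsK d) ^ n)
      (X 1 - X 2 : MvPolynomial (Fin 3) k) := by
  refine isSMulRegular_quotient_monomialSpan_pow fun S hS hmem => ?_
  refine hn.not_gt (lt_of_mem_assVars_expsK hS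
    (mem_of_mem_span_X_image_of_coeff_ne_zero hmem ?_)
    (mem_of_mem_span_X_image_of_coeff_ne_zero hmem ?_)) <;>
  simp [coeff_X, Finsupp.single_left_inj]

theorem two_le_depth_quotient_monomialSpan_expsJ_pow {n : ℕ} (hn : n ≠ 0) (hnd : n ≤ d + 2) :
    2 ≤ depth (idealOfVars (Fin 4) k)
      (MvPolynomial (Fin 4) k ⧸ monomialSpan k (expsJ d) ^ n) := by
  refine two_le_depth_quotient (f := X 0 - X 1) (g := X 2 - X 3) idealOfVars_ne_top
    (monomialSpan_pow_le_idealOfVars (expsJ_ne_zero d) hn) (X_sub_X_mem_idealOfVars 0 1)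
    (X_sub_X_mem_idealOfVars 2 3) (isSMulRegular_X_zero_sub_X_one k d n) specializeXY_surjective
    ker_specializeXY ?_
  rw [map_specializeXY_monomialSpan_expsJ_pow]
  simpa using isSMulRegular_X_one_sub_X_two k d hnd

theorem depth_quotient_monomialSpan_expsJ_pow_eq_one {n : ℕ} (hn : d + 3 ≤ n) :
    depth (idealOfVars (Fin 4) k)
      (MvPolynomial (Fin 4) k ⧸ monomialSpan k (expsJ d) ^ n) = 1 := by
  have hreg := isSMulRegular_X_zero_sub_X_one k d n
  refine le_antisymm ?_ (one_le_depth_quotient idealOfVars_ne_top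
    (monomialSpan_pow_le_idealOfVars (expsJ_ne_zero d) (by omega)) (X_sub_X_mem_idealOfVars 0 1)
    hreg)
  have hP : idealOfVars (Fin 3) k ∈ associatedPrimes (MvPolynomial (Fin 3) k)
      (MvPolynomial (Fin 3) k ⧸ (monomialSpan k (expsJ d) ^ n).map (specializeXY k)) := by
    rw [map_specializeXY_monomialSpan_expsJ_pow, associatedPrimes_monomialSpan_pow]
    exact ⟨_, univ_mem_assVars_expsK hn, by simp [idealOfVars]⟩
  refine depth_quotient_le_one hreg specializeXY_surjective ker_specializeXY hP ?_
  rw [idealOfVars, Ideal.map_span, Ideal.span_le]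
  rintro _ ⟨_, ⟨i, rfl⟩, rfl⟩
  rw [specializeXY_X]
  exact Ideal.subset_span ⟨_, rfl⟩

theorem isDstab_idealJ : IsDstab (idealOfVars (Fin 4) k) (idealJ k (d + 2)) (d + 3) := by
  rw [idealJ_eq_monomialSpan]
  refine ⟨⟨by omega, fun n hn => ?_⟩, fun a ⟨_, h⟩ => ?_⟩
  · rw [depth_quotient_monomialSpan_expsJ_pow_eq_one k d hn,
      depth_quotient_monomialSpan_expsJ_pow_eq_one k d le_rfl]
  · by_contra! hlt
    have heq := (h (d + 3) hlt.le).trans (h (d + 2) (by omega)).symm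
    have htwo := two_le_depth_quotient_monomialSpan_expsJ_pow k d (by omega) le_rfl
    rw [← heq, depth_quotient_monomialSpan_expsJ_pow_eq_one k d le_rfl] at htwo
    exact absurd htwo (by decide)

end IdealJ

end PowerStability

theorem theorem2p3 (k : Type*) [Field k] :
    (∀ c : ℕ, ∃ I J : Ideal (MvPolynomial (Fin 4) k),
      I.IsHomogeneous (MvPolynomial.homogeneousSubmodule (Fin 4) k) ∧
      J.IsHomogeneous (MvPolynomial.homogeneousSubmodule (Fin 4) k) ∧
      (∃ a d : ℕ, PowerStability.IsAstab I a ∧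
        PowerStability.IsDstab (MvPolynomial.idealOfVars (Fin 4) k) I d ∧
        (c : ℤ) ≤ (a : ℤ) - (d : ℤ)) ∧
      (∃ a d : ℕ, PowerStability.IsAstab J a ∧
        PowerStability.IsDstab (MvPolynomial.idealOfVars (Fin 4) k) J d ∧
        (c : ℤ) ≤ (d : ℤ) - (a : ℤ))) ∧
    (∀ c : ℕ, 1 ≤ c →
      PowerStability.IsAstab (PowerStability.idealI k c) (c + 1) ∧
      PowerStability.IsDstab (MvPolynomial.idealOfVars (Fin 4) k)
        (PowerStability.idealI k c) 1) ∧
    (∀ c : ℕ, 2 ≤ c →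
      PowerStability.IsAstab (PowerStability.idealJ k c) 1 ∧
      PowerStability.IsDstab (MvPolynomial.idealOfVars (Fin 4) k)
        (PowerStability.idealJ k c) (c + 1)) := by
  refine ⟨fun c => ⟨PowerStability.idealI k (c + 1), PowerStability.idealJ k (c + 2),
    PowerStability.isHomogeneous_idealI k c, PowerStability.isHomogeneous_idealJ k c,
    ⟨c + 2, 1, PowerStability.isAstab_idealI k c, PowerStability.isDstab_idealI k c,
      by push_cast; omega⟩,
    ⟨1, c + 3, PowerStability.isAstab_idealJ k c, PowerStability.isDstab_idealJ k c,
      by push_cast; omega⟩⟩, fun c hc => ?_, fun c hc => ?_⟩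
  · obtain ⟨d, rfl⟩ := Nat.exists_eq_add_of_le' hc
    exact ⟨PowerStability.isAstab_idealI k d, PowerStability.isDstab_idealI k d⟩
  · obtain ⟨d, rfl⟩ := Nat.exists_eq_add_of_le' hc
    exact ⟨PowerStability.isAstab_idealJ k d, PowerStability.isDstab_idealJ k d⟩
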